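/- Write $x=(y,z)\in\mathbb R^2\times\mathbb R$, and let $B^1=\{\psi\in H^1(\mathbb R^3;\mathbb C): |y|\psi\in L^2(\mathbb R^3)\}$. Let $H=-\Delta_y+|y|^2$ and $V(\theta)=e^{-i\theta H}=\sum_{n\ge 0}e^{-2i(n+1)\theta}\Pi_n$, where $\Pi_n$ is the orthogonal projection of $L^2(\mathbb R^3)$ onto the eigenspace of $H$ for the eigenvalue $2(n+1)$. Fix $\sigma=2$ and, for $\psi\in B^1$, put $$N[\psi]=\int_0^{\pi/2}\!\int_{\mathbb R^3}|V(\theta)\psi|^{2\sigma+2}\,dx\,d\theta ,$$ $$S[\psi]=\tfrac12\int_{\mathbb R^3}\big(|\nabla_x\psi|^2+|y\psi|^2+|\psi|^2\big)dx-\frac1{\pi(\sigma+1)}N[\psi],$$ $$I[\psi]=\int_{\mathbb R^3}\big(|\nabla_x\psi|^2+|y\psi|^2+|\psi|^2\big)dx-\frac2\pi N[\psi],\qquad P[\psi]=2\int_{\mathbb R^3}|\partial_z\psi|^2dx-\frac{2\sigma}{\pi(\sigma+1)}N[\psi].$$ For real $a,b$ let $\psi^{a,b}_\mu(y,z)=e^{a\mu}\psi(y,e^{b\mu}z)$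 and $J^{a,b}[\psi]=\partial_\mu S[\psi^{a,b}_\mu]\big|_{\mu=0}$, and let $$d^{a,b}=\inf\{S[\psi]:\psi\in B^1\setminus\{0\},\ J^{a,b}[\psi]=0\},\qquad d=\inf\{S[\psi]:\psi\in B^1\setminus\{0\},\ I[\psi]=0\}$$ (note that $I=J^{1,0}$, so $d=d^{1,0}$, and that $P=J^{1,2}$). Define $$\mathcal K^{+}=\{\psi\in B^1:S[\psi]<d,\ P[\psi]\ge0\},\qquad \mathcal K^{-}=\{\psi\in B^1:S[\psi]<d,\ P[\psi]<0\},$$ $$\mathcal K^{a,b,+}=\{\psi\in B^1:S[\psi]<d,\ J^{a,b}[\psi]\ge0\},\qquad \mathcal K^{a,b,-}=\{\psi\in B^1:S[\psi]<d,\ J^{a,b}[\psi]<0\}.$$ **Proposition.** Let $\sigma=2$ and let $a,b\in\mathbb R$ satisfy $a>0$, $b\ge0$ and $2a-b\ge0$ (the borderline case $2a-b=\sigma a-b=0$ is included). Then $\mathcal K^{+}=\mathcal K^{a,b,+}$ and $\mathcal K^{-}=\mathcal K^{a,b,-}$. Moreover, if $2a-b>0$, the threshold satisfies $d=d^{a,b}$.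 -/

import Mathlib

open MeasureTheory
open scoped SchwartzMap LineDeriv ENNReal Topology

noncomputable section

namespace AveragedNLS

/-- Physical space `ℝ³ = ℝ² × ℝ`; a point is `x = (y, z)` with `y = (x 0, x 1)` and `z = x 2`. -/
abbrev X : Type := EuclideanSpace ℝ (Fin 3)

/-- The complex Hilbert space `L²(ℝ³)`. -/
abbrev L2 : Type := Lp ℂ 2 (volume : Measure X)

/-- The coordinate unit vectors of `ℝ³`. -/
def unitVec (i : Fin 3) : X := EuclideanSpace.single i 1

/-- `|y|²` as a function of `x = (y, z)`. -/
def ySq (x : X) : ℝ := x 0 ^ 2 + x 1 ^ 2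

/-! ### The space `B¹` -/

/-- `B¹ = {ψ ∈ H¹(ℝ³) : |y| ψ ∈ L²(ℝ³)}`. -/
def B1 : Set L2 :=
  {ψ | TemperedDistribution.MemSobolev 1 2 (ψ : 𝓢'(X, ℂ)) ∧
    MemLp (fun x : X => (Real.sqrt (ySq x) : ℂ) * ψ x) 2 volume}

open Classical in
/-- The distributional partial derivative `∂ᵢ ψ` of `ψ ∈ L²`, as an element of `L²`
(with value `0` when the distributional derivative is not an `L²` function, which does not happen
for `ψ ∈ H¹`). -/
def weakDeriv (i : Fin 3) (ψ : L2) : L2 :=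
  if h : ∃ g : L2, ∂_{unitVec i} (ψ : 𝓢'(X, ℂ)) = (g : 𝓢'(X, ℂ)) then h.choose else 0

/-- An `L²` function is determined by its tempered distribution, so `weakDeriv` is the
distributional derivative as soon as the latter is in `L²`. -/
theorem weakDeriv_eq {i : Fin 3} {ψ g : L2}
    (h : ∂_{unitVec i} (ψ : 𝓢'(X, ℂ)) = (g : 𝓢'(X, ℂ))) : weakDeriv i ψ = g := by
  have hex : ∃ g : L2, ∂_{unitVec i} (ψ : 𝓢'(X, ℂ)) = (g : 𝓢'(X, ℂ)) := ⟨g, h⟩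
  have h1 := hex.choose_spec
  rw [weakDeriv, dif_pos hex]
  have hinj : Function.Injective (Lp.toTemperedDistributionCLM ℂ (volume : Measure X) 2) :=
    LinearMap.ker_eq_bot.mp Lp.ker_toTemperedDistributionCLM_eq_bot
  exact hinj (h1.symm.trans h)

/-! ### The partial harmonic oscillator and its propagator -/

theorem ySq_hasTemperateGrowth : (fun x : X => (ySq x : ℂ)).HasTemperateGrowth := by
  have h (i : Fin 3) : (fun x : X => x i).HasTemperateGrowth :=
    (EuclideanSpace.proj i : X →L[ℝ] ℝ).hasTemperateGrowth
  exact Function.HasTemperateGrowth.comp Function.Complex.hasTemperateGrowth_ofReal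
    (((h 0).pow 2).add ((h 1).pow 2))

/-- `H = -Δ_y + |y|²`, acting on tempered distributions on `ℝ³`. -/
def H : 𝓢'(X, ℂ) →L[ℂ] 𝓢'(X, ℂ) :=
  -(LineDeriv.lineDerivOpCLM ℂ 𝓢'(X, ℂ) (unitVec 0) ∘L
      LineDeriv.lineDerivOpCLM ℂ 𝓢'(X, ℂ) (unitVec 0) +
    LineDeriv.lineDerivOpCLM ℂ 𝓢'(X, ℂ) (unitVec 1) ∘L
      LineDeriv.lineDerivOpCLM ℂ 𝓢'(X, ℂ) (unitVec 1)) +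
    TemperedDistribution.smulLeftCLM ℂ (fun x : X => (ySq x : ℂ))

/-- The eigenspace in `L²(ℝ³)` of `H` (with its self-adjoint domain
`{f ∈ L² : H f ∈ L²}`) for the eigenvalue `2 (n + 1)`. -/
def eigenspace (n : ℕ) : Submodule ℂ L2 :=
  ((H - (2 * ((n : ℂ) + 1)) • ContinuousLinearMap.id ℂ 𝓢'(X, ℂ)) ∘L
    Lp.toTemperedDistributionCLM ℂ (volume : Measure X) 2).ker

theorem mem_eigenspace_iff (n : ℕ) (f : L2) :
    f ∈ eigenspace n ↔ H (f : 𝓢'(X, ℂ)) = (2 * ((n : ℂ) + 1)) • (f : 𝓢'(X, ℂ)) := by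
  simp [eigenspace, sub_eq_zero]

instance (n : ℕ) : CompleteSpace (eigenspace n) :=
  (ContinuousLinearMap.isClosed_ker _).completeSpace_coe

/-- The orthogonal projection `Π_n` of `L²(ℝ³)` onto the eigenspace of `H` for `2 (n + 1)`. -/
def hermiteProj (n : ℕ) : L2 →L[ℂ] L2 := (eigenspace n).starProjection

/-- The propagator `V(θ) = e^{-iθH} = ∑ₙ e^{-2i(n+1)θ} Π_n` on `L²(ℝ³)`
(the eigenvalues of `H` are `2 (n + 1)`, `n = 0, 1, 2, …`); the sum is taken in `L²`. -/
def V (θ : ℝ) (ψ : L2) : L2 :=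
  ∑' n : ℕ, Complex.exp (-Complex.I * (2 * ((n : ℂ) + 1)) * (θ : ℂ)) • hermiteProj n ψ

/-! ### The functionals (focusing case) -/

/-- `‖V(θ)ψ‖_{L^{2σ+2}_{θ,x}([0,π/2]×ℝ³)}^{2σ+2}`. -/
def potential (σ : ℝ) (ψ : L2) : ℝ :=
  ∫ θ in (0 : ℝ)..(Real.pi / 2), ∫ x : X, ‖V θ ψ x‖ ^ (2 * σ + 2)

/-- Mass `M[ψ] = ½ ‖ψ‖²`. -/
def mass (ψ : L2) : ℝ := 1 / 2 * ∫ x : X, ‖ψ x‖ ^ 2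

/-- Kinetic energy `K[ψ] = ½ (‖∇_y ψ‖² + ‖y ψ‖²)`. -/
def kinetic (ψ : L2) : ℝ :=
  1 / 2 * (‖weakDeriv 0 ψ‖ ^ 2 + ‖weakDeriv 1 ψ‖ ^ 2 + ∫ x : X, ySq x * ‖ψ x‖ ^ 2)

/-- Hamiltonian `E[ψ] = ½ ‖∂_z ψ‖² - (1 / (π (σ + 1))) ‖V(θ)ψ‖_{2σ+2}^{2σ+2}`. -/
def energy (σ : ℝ) (ψ : L2) : ℝ :=
  1 / 2 * ‖weakDeriv 2 ψ‖ ^ 2 - 1 / (Real.pi * (σ + 1)) * potential σ ψ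

/-- The action `S = K + M + E`. -/
def action (σ : ℝ) (ψ : L2) : ℝ := kinetic ψ + mass ψ + energy σ ψ

/-- The Nehari functional
`I[ψ] = ‖∇_x ψ‖² + ‖y ψ‖² + ‖ψ‖² - (2 / π) ‖V(θ)ψ‖_{2σ+2}^{2σ+2}`. -/
def nehari (σ : ℝ) (ψ : L2) : ℝ :=
  ‖weakDeriv 0 ψ‖ ^ 2 + ‖weakDeriv 1 ψ‖ ^ 2 + ‖weakDeriv 2 ψ‖ ^ 2 +
    (∫ x : X, ySq x * ‖ψ x‖ ^ 2) + (∫ x : X, ‖ψ x‖ ^ 2) - 2 / Real.pi * potential σ ψ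

/-- `P[ψ] = 2 ‖∂_z ψ‖² - (2σ / (π (σ + 1))) ‖V(θ)ψ‖_{2σ+2}^{2σ+2}`. -/
def virial (σ : ℝ) (ψ : L2) : ℝ :=
  2 * ‖weakDeriv 2 ψ‖ ^ 2 - 2 * σ / (Real.pi * (σ + 1)) * potential σ ψ

/-! ### The scaling and the functionals `J^{a,b}` -/

/-- The dilation `(y, z) ↦ (y, c z)`. -/
def zDilation (c : ℝ) : X →ₗ[ℝ] X :=
  Matrix.toEuclideanLin (Matrix.diagonal ![1, 1, c])

theorem zDilation_apply (c : ℝ) (x : X) : zDilation c x = !₂[x 0, x 1, c * x 2] := by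
  ext i
  fin_cases i <;> simp [zDilation, Matrix.toLpLin_apply, Matrix.mulVec_diagonal]

theorem det_zDilation (c : ℝ) : LinearMap.det (zDilation c) = c := by
  rw [zDilation, Matrix.toEuclideanLin, Matrix.toLpLin_eq_toLin, LinearMap.det_toLin, Matrix.det_diagonal]
  simp [Fin.prod_univ_three]

theorem memLp_comp_zDilation (c : ℝ) (hc : c ≠ 0) (ψ : L2) :
    MemLp (fun x : X => ψ (zDilation c x)) 2 volume := by
  have hmap : Measure.map (zDilation c) (volume : Measure X) =
      ENNReal.ofReal |(LinearMap.det (zDilation c))⁻¹| • (volume : Measure X) :=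
    Measure.map_linearMap_addHaar_eq_smul_addHaar _ (by rwa [det_zDilation])
  have hψ : MemLp ψ 2 (Measure.map (zDilation c) (volume : Measure X)) := by
    rw [hmap]
    exact (Lp.memLp ψ).smul_measure ENNReal.ofReal_ne_top
  exact hψ.comp_of_map (zDilation c).continuous_of_finiteDimensional.measurable.aemeasurable

/-- The scaling `ψ_μ^{a,b}(y, z) = e^{aμ} ψ(y, e^{bμ} z)`. -/
def scaling (a b μ : ℝ) (ψ : L2) : L2 :=
  (Real.exp (a * μ) : ℂ) •
    (memLp_comp_zDilation (Real.exp (b * μ)) (Real.exp_ne_zero _) ψ).toLp _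

/-- `J^{a,b}[ψ] = ∂_μ S[ψ_μ^{a,b}]` at `μ = 0`. -/
def J (σ a b : ℝ) (ψ : L2) : ℝ := deriv (fun μ : ℝ => action σ (scaling a b μ ψ)) 0

/-- `d^{a,b} = inf {S[ψ] : ψ ∈ B¹ \ {0}, J^{a,b}[ψ] = 0}`. -/
def dab (σ a b : ℝ) : ℝ := sInf (action σ '' {ψ | ψ ∈ B1 ∧ ψ ≠ 0 ∧ J σ a b ψ = 0})

/-- The action threshold `d = inf {S[ψ] : ψ ∈ B¹ \ {0}, I[ψ] = 0}`,
the action of the ground state. -/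
def threshold (σ : ℝ) : ℝ := sInf (action σ '' {ψ | ψ ∈ B1 ∧ ψ ≠ 0 ∧ nehari σ ψ = 0})

/-! ### The sets `K^±` and `K^{a,b,±}` -/

/-- `K⁺ = {ψ ∈ B¹ : S[ψ] < d, P[ψ] ≥ 0}`. -/
def KPlus (σ : ℝ) : Set L2 := {ψ | ψ ∈ B1 ∧ action σ ψ < threshold σ ∧ 0 ≤ virial σ ψ}

/-- `K⁻ = {ψ ∈ B¹ : S[ψ] < d, P[ψ] < 0}`. -/
def KMinus (σ : ℝ) : Set L2 := {ψ | ψ ∈ B1 ∧ action σ ψ < threshold σ ∧ virial σ ψ < 0}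

/-- `K^{a,b,+} = {ψ ∈ B¹ : S[ψ] < d, J^{a,b}[ψ] ≥ 0}`. -/
def KabPlus (σ a b : ℝ) : Set L2 := {ψ | ψ ∈ B1 ∧ action σ ψ < threshold σ ∧ 0 ≤ J σ a b ψ}

/-- `K^{a,b,-} = {ψ ∈ B¹ : S[ψ] < d, J^{a,b}[ψ] < 0}`. -/
def KabMinus (σ a b : ℝ) : Set L2 := {ψ | ψ ∈ B1 ∧ action σ ψ < threshold σ ∧ J σ a b ψ < 0}

end AveragedNLS

end

noncomputable section

namespace AveragedNLS

/-! ### `H¹` through the first derivatives -/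

/-! For `ψ ∈ B¹` only three numbers matter: the transversal part A = `transversal ψ`, the
longitudinal part B = `longitudinal ψ` and n = `interaction ψ`, with S = (A + B)/2 - n/3. Because `V
θ` acts only in y, it commutes with dilations in z. Passing to s ψ(y, cz) therefore multiplies A, B,
n by s²/c, s²c, s⁶/c, and `J`, `nehari` and `virial` all become `scalingDeriv α β`, with weights (2a
- b, 2a + b), (2, 2) and (0, 4).

If A, B, n > 0, the orbit under (s, c) contains a point with A = 2B and n = 3B/2, where
`scalingDeriv` vanishes for all weights at once. The quotient A²B/n is constant on the orbit, and
the action at that point is the square root of 3A²B/(8n). By `saddle_le` the action is at least this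
value wherever `scalingDeriv α β` vanishes with α ≥ 0, β > 0. Hence `exists_scaling_le`: a
constraint can be exchanged for another without raising the action, which gives equality of the
infima.

For the signs, `scalingDeriv` is linear in its weights. If two admissible weights gave values j < 0
≤ j', a nonnegative combination of the weights would give zero, forcing S ≥ d. No minimizer and no
compactness is needed. -/

open TemperedDistribution in
theorem besselPotential_two_eq (f : 𝓢'(X, ℂ)) :
    besselPotential X ℂ 2 f =
      f - ((2 * Real.pi) ^ 2)⁻¹ • ∑ i : Fin 3, ∂_{unitVec i} (∂_{unitVec i} f) := by
  have hΔ : ∑ i : Fin 3, ∂_{unitVec i} (∂_{unitVec i} f) = Laplacian.laplacian f := by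
    rw [laplacian_eq_sum (EuclideanSpace.basisFun (Fin 3) ℝ)]
    simp [unitVec]
  rw [hΔ, laplacian_eq_fourierMultiplierCLM, besselPotential]
  -- The Fourier transform has kernel e^{-2πi x·ξ}, so the symbol 1 + |ξ|² belongs to 1 - Δ/(2π)².
  have h1 : (fun x : X ↦ (((1 + ‖x‖ ^ 2) ^ ((2 : ℝ) / 2) : ℝ) : ℂ)) =
      fun x ↦ ∑ j : Fin 2, (![fun _ ↦ 1, fun x ↦ Complex.ofReal (‖x‖ ^ 2)] : Fin 2 → X → ℂ) j x := by
    ext x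
    simp [Fin.sum_univ_two]
  have h2 := fourierMultiplierCLM_sum (F := ℂ) (E := X) (s := (Finset.univ : Finset (Fin 2)))
    (g := ![fun _ ↦ 1, fun x ↦ Complex.ofReal (‖x‖ ^ 2)]) (by
      intro i _
      fin_cases i
      · exact Function.HasTemperateGrowth.const 1
      · simp only [Fin.mk_one, Matrix.cons_val_one, Matrix.cons_val_zero]
        fun_prop)
  rw [h1, h2, Fin.sum_univ_two]
  simp only [Matrix.cons_val_zero, Matrix.cons_val_one, fourierMultiplierCLM_const]
  have hπ : (2 * Real.pi) ^ 2 ≠ 0 := by positivity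
  rw [neg_smul, smul_neg, smul_smul, inv_mul_cancel₀ hπ]
  simp

open TemperedDistribution in
/-- A tempered distribution is in `H¹(ℝ³)` as soon as it and its first derivatives are in `L²`. -/
theorem memSobolev_one_of_lineDerivOp {f : 𝓢'(X, ℂ)} (hf : MemSobolev 0 2 f)
    (hd : ∀ i : Fin 3, MemSobolev 0 2 (∂_{unitVec i} f)) : MemSobolev 1 2 f := by
  -- The operator 1 - Δ/(2π)² shifts the order by exactly two, so it suffices to place its image in
  -- H⁻¹.
  have h : MemSobolev (-1) 2 (besselPotential X ℂ 2 f) := by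
    rw [besselPotential_two_eq]
    have hf' : MemSobolev (-1) 2 f := hf.mono (by norm_num)
    have hs : MemSobolev (-1) 2 (∑ i : Fin 3, ∂_{unitVec i} (∂_{unitVec i} f)) := by
      rw [Fin.sum_univ_three]
      have h' (i : Fin 3) := (hd i).lineDerivOp (m := unitVec i)
      simp only [zero_sub] at h'
      exact ((h' 0).add (h' 1)).add (h' 2)
    exact hf'.sub (hs.smul ((((2 * Real.pi) ^ 2)⁻¹ : ℝ) : ℂ))
  rwa [memSobolev_besselPotential_iff, show (2 : ℝ) + -1 = 1 by norm_num] at h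

open TemperedDistribution in
theorem toTemperedDistribution_weakDeriv {ψ : L2} (hψ : MemSobolev 1 2 (ψ : 𝓢'(X, ℂ)))
    (i : Fin 3) : ∂_{unitVec i} (ψ : 𝓢'(X, ℂ)) = (weakDeriv i ψ : 𝓢'(X, ℂ)) := by
  have h := hψ.lineDerivOp (m := unitVec i)
  rw [sub_self, memSobolev_zero_iff] at h
  obtain ⟨g, hg⟩ := h
  rw [weakDeriv_eq hg, hg]

/-! ### Dilations in `z` -/

/-- The dilation `(y, z) ↦ (y, c z)`, `c ≠ 0`, as a continuous linear equivalence. -/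
def zDilationEquiv (c : ℝ) (hc : c ≠ 0) : X ≃L[ℝ] X :=
  (LinearEquiv.ofLinearMap (zDilation c) (zDilation c⁻¹)
    (by ext1 x; ext i; fin_cases i <;> simp [zDilation_apply, hc])
    (by ext1 x; ext i; fin_cases i <;> simp [zDilation_apply, hc])).toContinuousLinearEquiv

@[simp]
theorem zDilationEquiv_symm_apply (c : ℝ) (hc : c ≠ 0) (x : X) :
    (zDilationEquiv c hc).symm x = zDilation c⁻¹ x := rfl

theorem zDilation_inv_zDilation {c : ℝ} (hc : c ≠ 0) (x : X) :
    zDilation c⁻¹ (zDilation c x) = x :=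
  (zDilationEquiv c hc).symm_apply_apply x

theorem map_zDilation {c : ℝ} (hc : c ≠ 0) :
    Measure.map (zDilation c) (volume : Measure X) =
      ENNReal.ofReal |c⁻¹| • (volume : Measure X) := by
  rw [Measure.map_linearMap_addHaar_eq_smul_addHaar _ (by rwa [det_zDilation]), det_zDilation]

theorem quasiMeasurePreserving_zDilation {c : ℝ} (hc : c ≠ 0) :
    Measure.QuasiMeasurePreserving (zDilation c) (volume : Measure X) volume := by
  refine ⟨(zDilation c).continuous_of_finiteDimensional.measurable, ?_⟩
  rw [map_zDilation hc]
  exact Measure.smul_absolutelyContinuous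

theorem integral_comp_zDilation {E : Type*} [NormedAddCommGroup E] [NormedSpace ℝ E] {c : ℝ}
    (hc : 0 < c) (F : X → E) : ∫ x, F (zDilation c x) = c⁻¹ • ∫ x, F x := by
  have h := (zDilationEquiv c hc.ne').toHomeomorph.measurableEmbedding.integral_map
    (μ := (volume : Measure X)) F
  have h' : ⇑(zDilationEquiv c hc.ne').toHomeomorph = zDilation c := rfl
  rw [h', map_zDilation hc.ne', integral_smul_measure,
    ENNReal.toReal_ofReal (abs_nonneg _), abs_of_pos (inv_pos.2 hc)] at h
  exact h.symm

/-- The dilation `ψ(y, z) ↦ ψ(y, c z)` of `L²` functions. -/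
def dil (c : ℝ) (hc : c ≠ 0) (ψ : L2) : L2 := (memLp_comp_zDilation c hc ψ).toLp _

theorem coeFn_dil {c : ℝ} (hc : c ≠ 0) (ψ : L2) :
    dil c hc ψ =ᵐ[volume] fun x ↦ ψ (zDilation c x) := MemLp.coeFn_toLp _

theorem dil_add {c : ℝ} (hc : c ≠ 0) (φ ψ : L2) :
    dil c hc (φ + ψ) = dil c hc φ + dil c hc ψ := by
  apply Lp.ext
  filter_upwards [coeFn_dil hc (φ + ψ), coeFn_dil hc φ, coeFn_dil hc ψ,
    Lp.coeFn_add (dil c hc φ) (dil c hc ψ),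
    (quasiMeasurePreserving_zDilation hc).ae (Lp.coeFn_add φ ψ)] with x h1 h2 h3 h4 h5
  rw [h1, h4, h5, Pi.add_apply, Pi.add_apply, h2, h3]

theorem dil_smul {c : ℝ} (hc : c ≠ 0) (r : ℂ) (ψ : L2) :
    dil c hc (r • ψ) = r • dil c hc ψ := by
  apply Lp.ext
  filter_upwards [coeFn_dil hc (r • ψ), coeFn_dil hc ψ, Lp.coeFn_smul r (dil c hc ψ),
    (quasiMeasurePreserving_zDilation hc).ae (Lp.coeFn_smul r ψ)] with x h1 h2 h3 h4
  rw [h1, h3, h4, Pi.smul_apply, Pi.smul_apply, h2]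

theorem dil_inv_dil {c : ℝ} (hc : c ≠ 0) (ψ : L2) :
    dil c hc (dil c⁻¹ (inv_ne_zero hc) ψ) = ψ := by
  apply Lp.ext
  filter_upwards [coeFn_dil hc (dil c⁻¹ (inv_ne_zero hc) ψ),
    (quasiMeasurePreserving_zDilation hc).ae (coeFn_dil (inv_ne_zero hc) ψ)] with x h1 h2
  rw [h1, h2, zDilation_inv_zDilation hc]

theorem dil_dil_inv {c : ℝ} (hc : c ≠ 0) (ψ : L2) :
    dil c⁻¹ (inv_ne_zero hc) (dil c hc ψ) = ψ := by
  have h := dil_inv_dil (inv_ne_zero hc) ψ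
  simpa only [inv_inv] using h

theorem inner_dil {c : ℝ} (hc : 0 < c) (φ ψ : L2) :
    inner ℂ (dil c hc.ne' φ) (dil c hc.ne' ψ) = c⁻¹ • inner ℂ φ ψ := by
  rw [L2.inner_def, L2.inner_def, ← integral_comp_zDilation hc]
  refine integral_congr_ae ?_
  filter_upwards [coeFn_dil hc.ne' φ, coeFn_dil hc.ne' ψ] with x h1 h2
  rw [h1, h2]

theorem norm_dil_sq {c : ℝ} (hc : 0 < c) (ψ : L2) :
    ‖dil c hc.ne' ψ‖ ^ 2 = c⁻¹ * ‖ψ‖ ^ 2 := by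
  have h := congrArg Complex.re (inner_dil hc ψ ψ)
  simp only [Complex.real_smul, Complex.re_ofReal_mul] at h
  rwa [← RCLike.re_to_complex, inner_self_eq_norm_sq, ← RCLike.re_to_complex,
    inner_self_eq_norm_sq] at h

/-- `dil c` as a continuous linear equivalence. -/
def dilEquiv (c : ℝ) (hc : 0 < c) : L2 ≃L[ℂ] L2 :=
  have key (c : ℝ) (hc : 0 < c) (ψ : L2) : ‖dil c hc.ne' ψ‖ ≤ √c⁻¹ * ‖ψ‖ := by
    apply le_of_sq_le_sq _ (by positivity)
    rw [norm_dil_sq hc, mul_pow, Real.sq_sqrt (by positivity)]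
  ContinuousLinearEquiv.equivOfInverse
    (LinearMap.mkContinuous ⟨⟨dil c hc.ne', dil_add hc.ne'⟩, dil_smul hc.ne'⟩ _ (key c hc))
    (LinearMap.mkContinuous ⟨⟨dil c⁻¹ (inv_ne_zero hc.ne'), dil_add (inv_ne_zero hc.ne')⟩,
      dil_smul (inv_ne_zero hc.ne')⟩ _
      (key c⁻¹ (inv_pos.2 hc)))
    (dil_dil_inv hc.ne') (dil_inv_dil hc.ne')

@[simp]
theorem dilEquiv_apply {c : ℝ} (hc : 0 < c) (ψ : L2) : dilEquiv c hc ψ = dil c hc.ne' ψ := rfl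

/-! ### Dilations and distributions -/

theorem toTemperedDistribution_smul (r : ℂ) (ψ : L2) :
    ((r • ψ : L2) : 𝓢'(X, ℂ)) = r • (ψ : 𝓢'(X, ℂ)) :=
  (Lp.toTemperedDistributionCLM ℂ (volume : Measure X) 2).map_smul r ψ

/-- Test functions composed with the inverse dilation. -/
def testDil (c : ℝ) (hc : c ≠ 0) : 𝓢(X, ℂ) →L[ℂ] 𝓢(X, ℂ) :=
  SchwartzMap.compCLMOfContinuousLinearEquiv ℂ (zDilationEquiv c hc).symm

@[simp]
theorem testDil_apply {c : ℝ} (hc : c ≠ 0) (φ : 𝓢(X, ℂ)) (x : X) :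
    testDil c hc φ x = φ (zDilation c⁻¹ x) := rfl

theorem toTemperedDistribution_dil {c : ℝ} (hc : 0 < c) (ψ : L2) (φ : 𝓢(X, ℂ)) :
    (dil c hc.ne' ψ : 𝓢'(X, ℂ)) φ = (c⁻¹ : ℂ) * (ψ : 𝓢'(X, ℂ)) (testDil c hc.ne' φ) := by
  rw [Lp.toTemperedDistribution_apply, Lp.toTemperedDistribution_apply]
  have h := integral_comp_zDilation hc (fun x ↦ testDil c hc.ne' φ x • ψ x)
  rw [Complex.real_smul, Complex.ofReal_inv] at h
  rw [← h]
  refine integral_congr_ae ?_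
  filter_upwards [coeFn_dil hc.ne' ψ] with x h1
  rw [h1, testDil_apply, zDilation_inv_zDilation hc.ne']

theorem zDilation_unitVec (c : ℝ) (i : Fin 3) :
    zDilation c (unitVec i) = (![1, 1, c] i) • unitVec i := by
  ext j
  fin_cases i <;> fin_cases j <;> simp [zDilation_apply, unitVec]

theorem testDil_lineDerivOp {c : ℝ} (hc : c ≠ 0) (i : Fin 3) (φ : 𝓢(X, ℂ)) :
    testDil c hc (∂_{unitVec i} φ) = (![1, 1, c] i) • ∂_{unitVec i} (testDil c hc φ) := by
  rw [testDil, SchwartzMap.lineDerivOp_compCLMOfContinuousLinearEquiv, zDilationEquiv_symm_apply,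
    zDilation_unitVec, LineDeriv.lineDerivOp_left_smul, ContinuousLinearMap.map_smul_of_tower, smul_smul]
  fin_cases i <;> simp [hc]

theorem testDil_smulLeftCLM_ySq {c : ℝ} (hc : c ≠ 0) (φ : 𝓢(X, ℂ)) :
    testDil c hc (SchwartzMap.smulLeftCLM ℂ (fun x : X ↦ (ySq x : ℂ)) φ) =
      SchwartzMap.smulLeftCLM ℂ (fun x : X ↦ (ySq x : ℂ)) (testDil c hc φ) := by
  ext x
  rw [testDil_apply, SchwartzMap.smulLeftCLM_apply_apply ySq_hasTemperateGrowth,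
    SchwartzMap.smulLeftCLM_apply_apply ySq_hasTemperateGrowth, testDil_apply]
  simp [ySq, zDilation_apply]

theorem lineDerivOp_dil {c : ℝ} (hc : 0 < c) (i : Fin 3) {ψ g : L2}
    (h : ∂_{unitVec i} (ψ : 𝓢'(X, ℂ)) = (g : 𝓢'(X, ℂ))) :
    ∂_{unitVec i} (dil c hc.ne' ψ : 𝓢'(X, ℂ)) =
      ((((![1, 1, c] i : ℝ) : ℂ) • dil c hc.ne' g : L2) : 𝓢'(X, ℂ)) := by
  ext φ
  have h' := DFunLike.congr_fun h (testDil c hc.ne' φ)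
  rw [TemperedDistribution.lineDerivOp_apply_apply] at h' ⊢
  rw [toTemperedDistribution_smul]
  change _ = (_ : ℂ) • (dil c hc.ne' g : 𝓢'(X, ℂ)) φ
  rw [toTemperedDistribution_dil hc, toTemperedDistribution_dil hc, ← h', map_neg, testDil_lineDerivOp,
    ← smul_neg]
  have hs : (ψ : 𝓢'(X, ℂ)) ((![1, 1, c] i) • -∂_{unitVec i} (testDil c hc.ne' φ)) =
      (![1, 1, c] i) • (ψ : 𝓢'(X, ℂ)) (-∂_{unitVec i} (testDil c hc.ne' φ)) :=
    ContinuousLinearMap.map_smul_of_tower _ _ _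
  rw [hs, Complex.real_smul, smul_eq_mul]
  ring

theorem H_apply_apply (T : 𝓢'(X, ℂ)) (φ : 𝓢(X, ℂ)) :
    H T φ = T (-(∂_{unitVec 0} (∂_{unitVec 0} φ) + ∂_{unitVec 1} (∂_{unitVec 1} φ)) +
      SchwartzMap.smulLeftCLM ℂ (fun x : X ↦ (ySq x : ℂ)) φ) := by
  rw [map_add, map_neg, map_add]
  have h0 : (∂_{unitVec 0} (∂_{unitVec 0} T)) φ = T (∂_{unitVec 0} (∂_{unitVec 0} φ)) := by
    simp [LineDeriv.lineDerivOp_neg]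
  have h1 : (∂_{unitVec 1} (∂_{unitVec 1} T)) φ = T (∂_{unitVec 1} (∂_{unitVec 1} φ)) := by
    simp [LineDeriv.lineDerivOp_neg]
  rw [← h0, ← h1]
  rfl

/-- `H` differentiates and multiplies in y only, while the dilation changes z only. -/
theorem dil_mem_eigenspace {c : ℝ} (hc : 0 < c) {n : ℕ} {ψ : L2} (h : ψ ∈ eigenspace n) :
    dil c hc.ne' ψ ∈ eigenspace n := by
  rw [mem_eigenspace_iff] at h ⊢
  ext φ
  have h' := DFunLike.congr_fun h (testDil c hc.ne' φ)
  rw [H_apply_apply] at h' ⊢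
  change _ = (_ : ℂ) • (ψ : 𝓢'(X, ℂ)) (testDil c hc.ne' φ) at h'
  change _ = (_ : ℂ) • (dil c hc.ne' ψ : 𝓢'(X, ℂ)) φ
  rw [toTemperedDistribution_dil hc, toTemperedDistribution_dil hc, map_add (testDil c hc.ne'),
    map_neg (testDil c hc.ne'), map_add (testDil c hc.ne'), testDil_lineDerivOp, testDil_lineDerivOp, testDil_lineDerivOp, testDil_lineDerivOp,
    testDil_smulLeftCLM_ySq]
  simp only [Matrix.cons_val_zero, Matrix.cons_val_one, one_smul]
  rw [h', smul_eq_mul, smul_eq_mul]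
  ring

/-- A dilation multiplies inner products by a constant and maps the eigenspace onto itself, so it
also preserves the orthogonal complement. -/
theorem hermiteProj_dil {c : ℝ} (hc : 0 < c) (n : ℕ) (ψ : L2) :
    hermiteProj n (dil c hc.ne' ψ) = dil c hc.ne' (hermiteProj n ψ) := by
  refine Submodule.eq_starProjection_of_mem_of_inner_eq_zero
    (dil_mem_eigenspace hc (Submodule.starProjection_apply_mem _ _)) fun w hw ↦ ?_
  rw [← dil_inv_dil hc.ne' w, ← dilEquiv_apply hc ψ, ← dilEquiv_apply hc (hermiteProj n ψ),
    ← map_sub, dilEquiv_apply, inner_dil hc, hermiteProj,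
    Submodule.starProjection_inner_eq_zero _ _ (dil_mem_eigenspace (inv_pos.2 hc) hw), smul_zero]

theorem V_dil {c : ℝ} (hc : 0 < c) (θ : ℝ) (ψ : L2) :
    V θ (dil c hc.ne' ψ) = dil c hc.ne' (V θ ψ) := by
  -- An invertible continuous map passes through `tsum` whether or not the series is known to
  -- converge.
  rw [V, V, ← dilEquiv_apply hc, ← dilEquiv_apply hc, ContinuousLinearEquiv.map_tsum]
  simp only [dilEquiv_apply, map_smul, hermiteProj_dil hc]

theorem V_smul (θ : ℝ) (r : ℂ) (ψ : L2) : V θ (r • ψ) = r • V θ ψ := by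
  rw [V, V, ← tsum_const_smul'']
  simp only [map_smul, smul_comm r]

/-! ### The functionals under scaling -/

theorem scaling_eq (a b μ : ℝ) (ψ : L2) :
    scaling a b μ ψ = (Real.exp (a * μ) : ℂ) • dil (Real.exp (b * μ)) (Real.exp_ne_zero _) ψ := rfl

theorem integral_smul_dil {s c : ℝ} (hs : 0 < s) (hc : 0 < c) (w : X → ℝ)
    (hw : ∀ x, w (zDilation c x) = w x) (p : ℝ) (ψ : L2) :
    ∫ x, w x * ‖((s : ℂ) • dil c hc.ne' ψ : L2) x‖ ^ p =
      s ^ p * c⁻¹ * ∫ x, w x * ‖ψ x‖ ^ p := by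
  have h := integral_comp_zDilation hc (fun x ↦ w x * ‖ψ x‖ ^ p)
  rw [mul_assoc, ← smul_eq_mul (a := c⁻¹), ← h, ← integral_const_mul]
  refine integral_congr_ae ?_
  filter_upwards [Lp.coeFn_smul (s : ℂ) (dil c hc.ne' ψ), coeFn_dil hc.ne' ψ] with x h1 h2
  rw [h1, Pi.smul_apply, h2, norm_smul, Complex.norm_real, Real.norm_of_nonneg hs.le,
    Real.mul_rpow hs.le (norm_nonneg _), hw]
  ring

/-- `‖∇_y ψ‖² + ‖y ψ‖² + ‖ψ‖²`. -/
def transversal (ψ : L2) : ℝ :=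
  ‖weakDeriv 0 ψ‖ ^ 2 + ‖weakDeriv 1 ψ‖ ^ 2 + (∫ x : X, ySq x * ‖ψ x‖ ^ 2) + ∫ x : X, ‖ψ x‖ ^ 2

/-- `‖∂_z ψ‖²`. -/
def longitudinal (ψ : L2) : ℝ := ‖weakDeriv 2 ψ‖ ^ 2

theorem weakDeriv_smul_dil {c : ℝ} (hc : 0 < c) (s : ℂ) (i : Fin 3) {ψ : L2} (hψ : ψ ∈ B1) :
    weakDeriv i (s • dil c hc.ne' ψ) =
      s • (((![1, 1, c] i : ℝ) : ℂ) • dil c hc.ne' (weakDeriv i ψ)) := by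
  have h := lineDerivOp_dil hc i (toTemperedDistribution_weakDeriv hψ.1 i)
  apply weakDeriv_eq
  rw [toTemperedDistribution_smul, LineDeriv.lineDerivOp_smul, h, ← toTemperedDistribution_smul]

theorem norm_weakDeriv_smul_dil {s c : ℝ} (hc : 0 < c) (i : Fin 3) {ψ : L2} (hψ : ψ ∈ B1) :
    ‖weakDeriv i ((s : ℂ) • dil c hc.ne' ψ)‖ ^ 2 =
      s ^ 2 * c⁻¹ * ((![1, 1, c] i) ^ 2 * ‖weakDeriv i ψ‖ ^ 2) := by
  rw [weakDeriv_smul_dil hc _ i hψ, norm_smul, norm_smul, mul_pow, mul_pow, norm_dil_sq hc,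
    Complex.norm_real, Complex.norm_real, Real.norm_eq_abs, Real.norm_eq_abs, sq_abs, sq_abs]
  ring

theorem transversal_smul_dil {s c : ℝ} (hs : 0 < s) (hc : 0 < c) {ψ : L2} (hψ : ψ ∈ B1) :
    transversal ((s : ℂ) • dil c hc.ne' ψ) = s ^ 2 * c⁻¹ * transversal ψ := by
  have h1 := integral_smul_dil hs hc ySq (by simp [ySq, zDilation_apply]) 2 ψ
  have h2 := integral_smul_dil hs hc (fun _ ↦ 1) (by simp) 2 ψ
  simp only [Real.rpow_two, one_mul] at h1 h2
  rw [transversal, transversal, norm_weakDeriv_smul_dil hc 0 hψ, norm_weakDeriv_smul_dil hc 1 hψ,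
    h1, h2]
  simp only [Matrix.cons_val_zero, Matrix.cons_val_one]
  ring

theorem longitudinal_smul_dil {s c : ℝ} (hc : 0 < c) {ψ : L2} (hψ : ψ ∈ B1) :
    longitudinal ((s : ℂ) • dil c hc.ne' ψ) = s ^ 2 * c * longitudinal ψ := by
  rw [longitudinal, longitudinal, norm_weakDeriv_smul_dil hc 2 hψ]
  simp only [Matrix.cons_val]
  field_simp

theorem potential_smul_dil {s c : ℝ} (hs : 0 < s) (hc : 0 < c) (ψ : L2) :
    potential 2 ((s : ℂ) • dil c hc.ne' ψ) = s ^ 6 * c⁻¹ * potential 2 ψ := by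
  rw [potential, potential, ← intervalIntegral.integral_const_mul]
  congr 1
  ext θ
  have h := integral_smul_dil hs hc (fun _ ↦ 1) (by simp) (2 * 2 + 2) (V θ ψ)
  simp only [one_mul] at h
  rw [V_smul, V_dil hc, h, show (2 * 2 + 2 : ℝ) = ((6 : ℕ) : ℝ) by norm_num, Real.rpow_natCast]

theorem smul_dil_mem_B1 {c : ℝ} (hc : 0 < c) (s : ℂ) {ψ : L2} (hψ : ψ ∈ B1) :
    s • dil c hc.ne' ψ ∈ B1 := by
  constructor
  · rw [toTemperedDistribution_smul]
    refine TemperedDistribution.MemSobolev.smul _ (memSobolev_one_of_lineDerivOp ?_ fun i ↦ ?_)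
    · exact TemperedDistribution.memSobolev_zero_iff.2 ⟨_, rfl⟩
    · rw [lineDerivOp_dil hc i (toTemperedDistribution_weakDeriv hψ.1 i)]
      exact TemperedDistribution.memSobolev_zero_iff.2 ⟨_, rfl⟩
  · have hψ' : MemLp (fun x : X ↦ (Real.sqrt (ySq x) : ℂ) * ψ x) 2
        (Measure.map (zDilation c) (volume : Measure X)) := by
      rw [map_zDilation hc.ne']
      exact hψ.2.smul_measure ENNReal.ofReal_ne_top
    have h := (hψ'.comp_of_map
      (zDilation c).continuous_of_finiteDimensional.measurable.aemeasurable).const_smul s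
    refine h.ae_eq ?_
    filter_upwards [Lp.coeFn_smul s (dil c hc.ne' ψ), coeFn_dil hc.ne' ψ] with x h1 h2
    rw [h1, Pi.smul_apply, Pi.smul_apply, h2]
    simp [ySq, zDilation_apply]
    ring

theorem smul_dil_ne_zero {s c : ℝ} (hs : 0 < s) (hc : 0 < c) {ψ : L2} (hψ : ψ ≠ 0) :
    (s : ℂ) • dil c hc.ne' ψ ≠ 0 := by
  refine smul_ne_zero (by exact_mod_cast hs.ne') ?_
  rw [← dilEquiv_apply hc]
  exact (map_ne_zero_iff _ (dilEquiv c hc).injective).2 hψ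

/-- `π⁻¹ ‖V(θ)ψ‖₆⁶`. -/
def interaction (ψ : L2) : ℝ := potential 2 ψ / Real.pi

theorem interaction_smul_dil {s c : ℝ} (hs : 0 < s) (hc : 0 < c) (ψ : L2) :
    interaction ((s : ℂ) • dil c hc.ne' ψ) = s ^ 6 * c⁻¹ * interaction ψ := by
  rw [interaction, interaction, potential_smul_dil hs hc, mul_div_assoc]

theorem interaction_nonneg (ψ : L2) : 0 ≤ interaction ψ := by
  refine div_nonneg (intervalIntegral.integral_nonneg (by positivity) fun θ _ ↦ ?_)
    Real.pi_pos.le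
  exact integral_nonneg fun x ↦ by positivity

theorem interaction_zero : interaction 0 = 0 := by
  -- Homogeneity gives x = 64 x for the value x at zero.
  have h := interaction_smul_dil (s := 2) (c := 1) two_pos one_pos 0
  rw [← dilEquiv_apply one_pos, map_zero, smul_zero] at h
  linarith

theorem longitudinal_nonneg (ψ : L2) : 0 ≤ longitudinal ψ := sq_nonneg _

theorem integral_norm_sq_eq (ψ : L2) : ∫ x : X, ‖ψ x‖ ^ 2 = ‖ψ‖ ^ 2 := by
  have h := L2.inner_def (𝕜 := ℂ) ψ ψ
  simp only [inner_self_eq_norm_sq_to_K] at h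
  norm_cast at h
  exact h.symm

theorem integral_norm_sq_le_transversal (ψ : L2) : ∫ x : X, ‖ψ x‖ ^ 2 ≤ transversal ψ := by
  have h : 0 ≤ ∫ x : X, ySq x * ‖ψ x‖ ^ 2 :=
    integral_nonneg fun x ↦ mul_nonneg (add_nonneg (sq_nonneg _) (sq_nonneg _)) (sq_nonneg _)
  rw [transversal]
  nlinarith [sq_nonneg ‖weakDeriv 0 ψ‖, sq_nonneg ‖weakDeriv 1 ψ‖]

theorem transversal_nonneg (ψ : L2) : 0 ≤ transversal ψ :=
  (integral_nonneg fun _ ↦ sq_nonneg _).trans (integral_norm_sq_le_transversal ψ)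

theorem transversal_pos {ψ : L2} (hψ : ψ ≠ 0) : 0 < transversal ψ := by
  refine lt_of_lt_of_le ?_ (integral_norm_sq_le_transversal ψ)
  rw [integral_norm_sq_eq]
  have := norm_pos_iff.2 hψ
  positivity

/-! ### The functionals in terms of A, B and n -/

theorem action_eq (ψ : L2) :
    action 2 ψ = (transversal ψ + longitudinal ψ) / 2 - interaction ψ / 3 := by
  have := Real.pi_ne_zero
  rw [action, kinetic, mass, energy, transversal, longitudinal, interaction]
  field_simp
  ring

/-- The derivative of the action along the scaling for which the transversal, longitudinal and
interaction parts are homogeneous of degrees `α`, `β` and `2α + β`. -/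
def scalingDeriv (α β : ℝ) (ψ : L2) : ℝ :=
  (α * transversal ψ + β * longitudinal ψ) / 2 - (2 * α + β) * interaction ψ / 3

theorem nehari_eq (ψ : L2) : nehari 2 ψ = scalingDeriv 2 2 ψ := by
  have := Real.pi_ne_zero
  rw [nehari, scalingDeriv, transversal, longitudinal, interaction]
  field_simp
  ring

theorem virial_eq (ψ : L2) : virial 2 ψ = scalingDeriv 0 4 ψ := by
  have := Real.pi_ne_zero
  rw [virial, scalingDeriv, longitudinal, interaction]
  field_simp
  ring

theorem action_scaling (a b μ : ℝ) {ψ : L2} (hψ : ψ ∈ B1) :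
    action 2 (scaling a b μ ψ) =
      (Real.exp ((2 * a - b) * μ) * transversal ψ + Real.exp ((2 * a + b) * μ) * longitudinal ψ) / 2
        - Real.exp ((6 * a - b) * μ) * interaction ψ / 3 := by
  have hs := Real.exp_pos (a * μ)
  have hc := Real.exp_pos (b * μ)
  rw [scaling_eq, action_eq, transversal_smul_dil hs hc hψ, longitudinal_smul_dil hc hψ,
    interaction_smul_dil hs hc, ← Real.exp_neg, ← Real.exp_nat_mul, ← Real.exp_nat_mul,
    ← Real.exp_add, ← Real.exp_add, ← Real.exp_add]
  push_cast
  ring_nf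

theorem J_eq (a b : ℝ) {ψ : L2} (hψ : ψ ∈ B1) :
    J 2 a b ψ = scalingDeriv (2 * a - b) (2 * a + b) ψ := by
  have hexp (k C : ℝ) : HasDerivAt (fun μ : ℝ ↦ Real.exp (k * μ) * C) (k * C) 0 := by
    have h := (((hasDerivAt_id (0 : ℝ)).const_mul k).exp).mul_const C
    simpa using h
  have h := (((hexp (2 * a - b) (transversal ψ)).add
    (hexp (2 * a + b) (longitudinal ψ))).div_const 2).sub
      ((hexp (6 * a - b) (interaction ψ)).div_const 3)
  rw [J, funext fun μ ↦ action_scaling a b μ hψ, scalingDeriv]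
  refine h.deriv.trans ?_
  ring

/-! ### Minimization along the orbits of the scalings -/

/-- The action on `{scalingDeriv α β = 0}` is at least its value at
the saddle point of the orbit. -/
theorem saddle_le {A B n α β : ℝ} (hA : 0 ≤ A) (hB : 0 ≤ B) (hα : 0 ≤ α) (hβ : 0 < β)
    (h : (α * A + β * B) / 2 - (2 * α + β) * n / 3 = 0) :
    3 * A ^ 2 * B ≤ 8 * n * ((A + B) / 2 - n / 3) ^ 2 := by
  have hγ : 0 < 2 * α + β := by positivity
  have hn : n = 3 * (α * A + β * B) / (2 * (2 * α + β)) := by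
    field_simp
    linarith
  -- The factor (A - 2B)² reflects that equality holds at the saddle, where A = 2B.
  have key : 8 * n * ((A + B) / 2 - n / 3) ^ 2 - 3 * A ^ 2 * B =
      3 * (A - 2 * B) ^ 2 * (α * (α + β) ^ 2 * A + β * α ^ 2 * B) / (2 * α + β) ^ 3 := by
    rw [hn]
    field_simp
    ring
  have : 0 ≤ 3 * (A - 2 * B) ^ 2 * (α * (α + β) ^ 2 * A + β * α ^ 2 * B) / (2 * α + β) ^ 3 := by
    positivity
  linarith

/-- Eliminating n leaves a nonnegative combination of A and B. This bounds the constrained actions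
below, as `csInf_le` requires, and lets actions be compared through their squares. -/
theorem action_nonneg_of_scalingDeriv_eq_zero {A B n α β : ℝ} (hA : 0 ≤ A) (hB : 0 ≤ B)
    (hα : 0 ≤ α) (hβ : 0 < β) (h : (α * A + β * B) / 2 - (2 * α + β) * n / 3 = 0) :
    0 ≤ (A + B) / 2 - n / 3 := by
  have hγ : 0 < 2 * α + β := by positivity
  have hS : (A + B) / 2 - n / 3 = ((α + β) * A + 2 * α * B) / (2 * (2 * α + β)) := by
    field_simp
    linarith
  rw [hS]
  positivity

/-- For B > 0 the witness is the saddle, which does not depend on the weights. For B = 0 there is no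
saddle: the new constraint fixes s alone, the action is then proportional to c⁻¹, and c is chosen to
reproduce the old action exactly. -/
theorem exists_scaling_le {A B n α β α' β' : ℝ} (hA : 0 < A) (hB : 0 ≤ B) (hn : 0 < n)
    (hα : 0 ≤ α) (hβ : 0 < β) (h : (α * A + β * B) / 2 - (2 * α + β) * n / 3 = 0)
    (hα' : 0 < α') (hβ' : 0 < β') :
    ∃ s > 0, ∃ c > 0,
      (α' * (s ^ 2 * c⁻¹ * A) + β' * (s ^ 2 * c * B)) / 2
        - (2 * α' + β') * (s ^ 6 * c⁻¹ * n) / 3 = 0 ∧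
      (s ^ 2 * c⁻¹ * A + s ^ 2 * c * B) / 2 - s ^ 6 * c⁻¹ * n / 3 ≤ (A + B) / 2 - n / 3 := by
  have root (q : ℝ) (hq : 0 < q) : ∃ s > 0, s ^ 4 = q :=
    ⟨√√q, by positivity, by
      rw [show 4 = 2 * 2 by norm_num, pow_mul, Real.sq_sqrt (by positivity),
        Real.sq_sqrt hq.le]⟩
  rcases hB.eq_or_lt with rfl | hB
  · have hS : 0 < (A + 0) / 2 - n / 3 := by
      have : n / 3 = α * A / (2 * (2 * α + β)) := by
        field_simp
        linarith
      have hS : (A + 0) / 2 - n / 3 = (α + β) * A / (2 * (2 * α + β)) := by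
        rw [this]
        field_simp
        ring
      rw [hS]
      positivity
    obtain ⟨s, hs, hs4⟩ := root (3 * α' * A / (2 * (2 * α' + β') * n)) (by positivity)
    have hs6 : s ^ 6 * n / 3 = s ^ 2 * (α' * A / (2 * (2 * α' + β'))) := by
      rw [show s ^ 6 = s ^ 2 * s ^ 4 by ring, hs4]
      field_simp
    have hT : s ^ 2 * A / 2 - s ^ 6 * n / 3 = s ^ 2 * ((α' + β') * A / (2 * (2 * α' + β'))) := by
      rw [hs6]
      field_simp
      ring
    have hTpos : 0 < s ^ 2 * A / 2 - s ^ 6 * n / 3 := by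
      rw [hT]
      positivity
    refine ⟨s, hs, (s ^ 2 * A / 2 - s ^ 6 * n / 3) / ((A + 0) / 2 - n / 3), by positivity, ?_, ?_⟩
    · generalize (s ^ 2 * A / 2 - s ^ 6 * n / 3) / ((A + 0) / 2 - n / 3) = c
      have : (α' * (s ^ 2 * c⁻¹ * A) + β' * (s ^ 2 * c * 0)) / 2
          - (2 * α' + β') * (s ^ 6 * c⁻¹ * n) / 3 =
          c⁻¹ * (α' * s ^ 2 * A / 2 - (2 * α' + β') * (s ^ 6 * n / 3)) := by ring
      rw [this, hs6]
      field_simp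
      ring
    · refine le_of_eq ?_
      generalize (A + 0) / 2 - n / 3 = S at hS
      rw [inv_div]
      have hT0 := hTpos.ne'
      generalize hT' : s ^ 2 * A / 2 - s ^ 6 * n / 3 = T at hT0
      have : (s ^ 2 * (S / T) * A + s ^ 2 * (T / S) * 0) / 2 - s ^ 6 * (S / T) * n / 3 =
          S / T * (s ^ 2 * A / 2 - s ^ 6 * n / 3) := by ring
      rw [this, hT', div_mul_cancel₀ _ hT0]
  -- These s and c solve n = 3A/4 and A = 2B for the rescaled quantities.
  · obtain ⟨s, hs, hs4⟩ := root (3 * A / (4 * n)) (by positivity)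
    have hc : 0 < √(A / (2 * B)) := by positivity
    have hc2 : √(A / (2 * B)) ^ 2 = A / (2 * B) := Real.sq_sqrt (by positivity)
    generalize √(A / (2 * B)) = c at hc hc2
    have hA' : s ^ 2 * c⁻¹ * A = 2 * (s ^ 2 * c * B) := by
      have : A = 2 * B * c ^ 2 := by
        rw [hc2]
        field_simp
      rw [this]
      field_simp
    have hn' : s ^ 6 * c⁻¹ * n = 3 / 2 * (s ^ 2 * c * B) := by
      have : s ^ 6 * c⁻¹ * n = 3 / 4 * (s ^ 2 * c⁻¹ * A) := by
        rw [show s ^ 6 = s ^ 2 * s ^ 4 by ring, hs4]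
        field_simp
      rw [this, hA']
      ring
    refine ⟨s, hs, c, hc, ?_, ?_⟩
    · rw [hA', hn']
      ring
    · rw [hA', hn']
      have hle := saddle_le hA.le hB.le hα hβ h
      have hS := action_nonneg_of_scalingDeriv_eq_zero hA.le hB.le hα hβ h
      refine le_trans (b := s ^ 2 * c * B) (le_of_eq (by ring)) ?_
      refine le_of_sq_le_sq ?_ hS
      have : (s ^ 2 * c * B) ^ 2 = 3 * A ^ 2 * B / (8 * n) := by
        rw [show (s ^ 2 * c * B) ^ 2 = s ^ 4 * c ^ 2 * B ^ 2 by ring, hs4, hc2]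
        field_simp
        ring
      rw [this, div_le_iff₀ (by positivity)]
      linarith

theorem exists_scalingDeriv_eq_zero_action_le {α β α' β' : ℝ} {ψ : L2} (hψ : ψ ∈ B1)
    (hn : 0 < interaction ψ) (hα : 0 ≤ α) (hβ : 0 < β) (h : scalingDeriv α β ψ = 0)
    (hα' : 0 < α') (hβ' : 0 < β') :
    ∃ φ ∈ B1, φ ≠ 0 ∧ scalingDeriv α' β' φ = 0 ∧ action 2 φ ≤ action 2 ψ := by
  have hψ0 : ψ ≠ 0 := by
    rintro rfl
    exact hn.ne' interaction_zero
  obtain ⟨s, hs, c, hc, h1, h2⟩ := exists_scaling_le (transversal_pos hψ0)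
    (longitudinal_nonneg ψ) hn hα hβ h hα' hβ'
  refine ⟨(s : ℂ) • dil c hc.ne' ψ, smul_dil_mem_B1 hc _ hψ, smul_dil_ne_zero hs hc hψ0, ?_, ?_⟩
  · rwa [scalingDeriv, transversal_smul_dil hs hc hψ, longitudinal_smul_dil hc hψ,
      interaction_smul_dil hs hc]
  · rwa [action_eq, action_eq, transversal_smul_dil hs hc hψ, longitudinal_smul_dil hc hψ,
      interaction_smul_dil hs hc]

/-- The actions of the nonzero `ψ ∈ B¹` at which `scalingDeriv α β` vanishes. -/
def constrainedActions (α β : ℝ) : Set ℝ :=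
  action 2 '' {ψ | ψ ∈ B1 ∧ ψ ≠ 0 ∧ scalingDeriv α β ψ = 0}

theorem bddBelow_constrainedActions {α β : ℝ} (hα : 0 ≤ α) (hβ : 0 < β) :
    BddBelow (constrainedActions α β) := by
  refine ⟨0, ?_⟩
  rintro _ ⟨ψ, ⟨-, -, h⟩, rfl⟩
  rw [action_eq]
  exact action_nonneg_of_scalingDeriv_eq_zero (transversal_nonneg ψ) (longitudinal_nonneg ψ)
    hα hβ h

/-- Strict α > 0 brings in the positive transversal part; for α = 0 the constraint says only that B
and n are proportional. This is where the equality of thresholds uses 2a - b > 0. -/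
theorem interaction_pos_of_scalingDeriv_eq_zero {α β : ℝ} (hα : 0 < α) (hβ : 0 < β) {ψ : L2}
    (hψ : ψ ≠ 0) (h : scalingDeriv α β ψ = 0) : 0 < interaction ψ := by
  have h1 := mul_pos hα (transversal_pos hψ)
  have h2 := mul_nonneg hβ.le (longitudinal_nonneg ψ)
  rw [scalingDeriv] at h
  have h3 : 0 < (2 * α + β) * interaction ψ := by linarith
  exact (mul_pos_iff_of_pos_left (by positivity)).1 h3

/-! ### Comparison of thresholds and of signs -/

theorem exists_mem_constrainedActions_le {α β α' β' : ℝ} (hα : 0 < α) (hβ : 0 < β) (hα' : 0 < α')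
    (hβ' : 0 < β') {t : ℝ} (ht : t ∈ constrainedActions α β) :
    ∃ t' ∈ constrainedActions α' β', t' ≤ t := by
  obtain ⟨ψ, ⟨hψ, hψ0, h⟩, rfl⟩ := ht
  obtain ⟨φ, hφ, hφ0, h1, h2⟩ := exists_scalingDeriv_eq_zero_action_le hψ
    (interaction_pos_of_scalingDeriv_eq_zero hα hβ hψ0 h) hα.le hβ h hα' hβ'
  exact ⟨_, ⟨φ, ⟨hφ, hφ0, h1⟩, rfl⟩, h2⟩

theorem sInf_constrainedActions_eq {α β α' β' : ℝ} (hα : 0 < α) (hβ : 0 < β) (hα' : 0 < α')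
    (hβ' : 0 < β') : sInf (constrainedActions α β) = sInf (constrainedActions α' β') := by
  rcases (constrainedActions α β).eq_empty_or_nonempty with he | hne
  -- The infimum of the empty set is 0 by convention, so both sets must be shown empty together.
  · rw [he, show constrainedActions α' β' = ∅ from Set.eq_empty_of_forall_notMem fun t ht ↦ by
      obtain ⟨t', ht', -⟩ := exists_mem_constrainedActions_le hα' hβ' hα hβ ht
      simp [he] at ht']
  · have hne' : (constrainedActions α' β').Nonempty :=
      let ⟨t', ht', _⟩ := exists_mem_constrainedActions_le hα hβ hα' hβ' hne.some_mem
      ⟨t', ht'⟩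
    apply le_antisymm
    · refine le_csInf hne' fun t ht ↦ ?_
      obtain ⟨t', ht', hle⟩ := exists_mem_constrainedActions_le hα' hβ' hα hβ ht
      exact (csInf_le (bddBelow_constrainedActions hα.le hβ) ht').trans hle
    · refine le_csInf hne fun t ht ↦ ?_
      obtain ⟨t', ht', hle⟩ := exists_mem_constrainedActions_le hα hβ hα' hβ' ht
      exact (csInf_le (bddBelow_constrainedActions hα'.le hβ') ht').trans hle

theorem threshold_eq : threshold 2 = sInf (constrainedActions 2 2) := by
  simp only [threshold, constrainedActions, nehari_eq]

theorem dab_eq (a b : ℝ) :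
    dab 2 a b = sInf (constrainedActions (2 * a - b) (2 * a + b)) := by
  rw [dab, constrainedActions]
  congr 2
  ext ψ
  exact and_congr_right fun hψ ↦ by rw [J_eq a b hψ]

/-- Below the threshold the sign of `scalingDeriv α β` does not depend on `(α, β)`. -/
theorem scalingDeriv_neg_of_neg {α β α' β' : ℝ} (hα : 0 ≤ α) (hβ : 0 < β) (hα' : 0 ≤ α')
    (hβ' : 0 < β') {ψ : L2} (hψ : ψ ∈ B1) (hS : action 2 ψ < threshold 2)
    (h : scalingDeriv α β ψ < 0) : scalingDeriv α' β' ψ < 0 := by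
  by_contra! h'
  -- Without interaction the first derivative could not be negative; this replaces the strict
  -- positivity of α, so α = 0 is allowed.
  have hn : 0 < interaction ψ := by
    refine (interaction_nonneg ψ).lt_of_ne' fun h0 ↦ ?_
    rw [scalingDeriv, h0] at h
    have h1 := mul_nonneg hα (transversal_nonneg ψ)
    have h2 := mul_nonneg hβ.le (longitudinal_nonneg ψ)
    linarith
  set j := scalingDeriv α β ψ
  set j' := scalingDeriv α' β' ψ
  -- The coefficients j' ≥ 0 and -j > 0 cancel the two values while keeping the first weight
  -- nonnegative and the second positive.
  have hcomb : scalingDeriv (j' * α + -j * α') (j' * β + -j * β') ψ = 0 := by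
    have : scalingDeriv (j' * α + -j * α') (j' * β + -j * β') ψ =
        j' * scalingDeriv α β ψ + -j * scalingDeriv α' β' ψ := by
      simp only [scalingDeriv]
      ring
    rw [this]
    ring
  have hj : 0 < -j := neg_pos.2 h
  obtain ⟨φ, hφ, hφ0, h1, h2⟩ := exists_scalingDeriv_eq_zero_action_le (α' := 2) (β' := 2) hψ hn
    (by positivity) (by positivity) hcomb two_pos two_pos
  have h3 := csInf_le (bddBelow_constrainedActions zero_le_two two_pos)
    ⟨φ, ⟨hφ, hφ0, h1⟩, rfl⟩
  rw [← threshold_eq] at h3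
  linarith

end AveragedNLS

end

theorem proposition3p7 (a b : ℝ) (ha : 0 < a) (hb : 0 ≤ b) (hab : 0 ≤ 2 * a - b) :
    (0 < 2 * a - b → AveragedNLS.dab 2 a b = AveragedNLS.threshold 2) ∧
    AveragedNLS.KPlus 2 = AveragedNLS.KabPlus 2 a b ∧
    AveragedNLS.KMinus 2 = AveragedNLS.KabMinus 2 a b := by
  have hβ : 0 < 2 * a + b := by positivity
  have hiff {ψ : AveragedNLS.L2} (hψ : ψ ∈ AveragedNLS.B1)
      (hS : AveragedNLS.action 2 ψ < AveragedNLS.threshold 2) :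
      AveragedNLS.virial 2 ψ < 0 ↔ AveragedNLS.J 2 a b ψ < 0 := by
    rw [AveragedNLS.virial_eq, AveragedNLS.J_eq a b hψ]
    -- `virial` itself has first weight 0, so the borderline 2a - b = 0 needs no separate argument.
    exact ⟨AveragedNLS.scalingDeriv_neg_of_neg le_rfl four_pos hab hβ hψ hS,
      AveragedNLS.scalingDeriv_neg_of_neg hab hβ le_rfl four_pos hψ hS⟩
  refine ⟨fun hα ↦ ?_, Set.ext fun ψ ↦ ?_, Set.ext fun ψ ↦ ?_⟩
  · rw [AveragedNLS.dab_eq, AveragedNLS.threshold_eq]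
    exact AveragedNLS.sInf_constrainedActions_eq hα hβ two_pos two_pos
  · exact and_congr_right fun hψ ↦ and_congr_right fun hS ↦ by
      simpa only [not_lt] using not_congr (hiff hψ hS)
  · exact and_congr_right fun hψ ↦ and_congr_right fun hS ↦ hiff hψ hS
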